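/- Let $\mathcal G$ be a locally compact, not necessarily Hausdorff, étale groupoid, that is, a groupoid with a locally compact topology such that the groupoid operations are continuous, the unit space $\mathcal G^{(0)}$ is locally compact Hausdorff in the relative topology, and the range and source maps $r,s\colon\mathcal G\to\mathcal G^{(0)}$ are local homeomorphisms. An open bisection is an open set $W\subset\mathcal G$ on which $r$ and $s$ are injective. Let $C_c(\mathcal G)$ be the linear span, in the space of functions $\mathcal G\to\mathbb C$, of the extensions by zero of continuous compactly supported functions on open Hausdorff subsets of $\mathcal G$. For $x\in\mathcal G^{(0)}$ put $\mathcal G_x=s^{-1}(x)$, $\mathcal G^x=r^{-1}(x)$, $\mathcal G^x_x=\mathcal G_x\cap\mathcal G^x$, and for $f\in C_c(\mathcal G)$ let $\rho_x(f)$ be the operator on $\ell^2(\mathcal G_x)$ given by $$(\rho_x(f)\xi)(g)=\sum_{h\in\mathcal G^{r(g)}}f(h)\,\xi(h^{-1}g).$$ Let $C^*_r(\mathcal G)$ be the completion of $C_c(\mathcal G)$ with respect to the norm $\|f\|_r=\sup_{x\in\mathcal G^{(0)}}\|\rho_x(f)\|$; each $\rho_x$ extends to $C^*_r(\mathcal G)$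 by continuity. Put $$J_{\mathrm{sing}}=\{a\in C^*_r(\mathcal G)\mid \text{the set of } x\in\mathcal G^{(0)} \text{ such that } \rho_x(a)\delta_x\neq0 \text{ is meager in } \mathcal G^{(0)}\}.$$ Assume that $\mathcal G$ can be covered by countably many open bisections. Let $D_0\subset\mathcal G^{(0)}$ be the set of points $x\in\mathcal G^{(0)}$ for which there exist finitely many elements $g_1,\dots,g_n\in\mathcal G^x_x\setminus\{x\}$, open bisections $U_1,\dots,U_n$ with $g_k\in U_k$ for all $k$, and an open neighbourhood $U$ of $x$ in $\mathcal G^{(0)}$ such that $U\setminus(U_1\cup\dots\cup U_n)$ has empty interior. Then, for every dense subset $Y$ of $\mathcal G^{(0)}\setminus D_0$, $$J_{\mathrm{sing}}=\{a\in C^*_r(\mathcal G)\mid \text{the set of } x\in\mathcal G^{(0)} \text{ such that } \rho_x(a)\neq0 \text{ is meager in } \mathcal G^{(0)}\}=\bigcap_{y\in Y}\ker\rho_y .$$ In particular, if $D_0=\emptyset$, then $J_{\mathrm{sing}}=0$. -/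

import Mathlib

/-- A groupoid, presented by its set `G` of arrows. Units are identified with identity arrows, so
the source and range maps are maps `G → G`. The product `mul g h` is meaningful only if
`src g = rng h`; its values on other pairs are irrelevant, no law or definition uses them. -/
class ArrowGroupoid (G : Type*) where
  src : G → G
  rng : G → G
  mul : G → G → G
  inv : G → G
  rng_src : ∀ g, rng (src g) = src g
  src_rng : ∀ g, src (rng g) = rng g
  src_mul : ∀ g h, src g = rng h → src (mul g h) = src h
  rng_mul : ∀ g h, src g = rng h → rng (mul g h) = rng g
  assoc : ∀ g h k, src g = rng h → src h = rng k → mul (mul g h) k = mul g (mul h k)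
  mul_src : ∀ g, mul g (src g) = g
  rng_mul_self : ∀ g, mul (rng g) g = g
  src_inv : ∀ g, src (inv g) = rng g
  rng_inv : ∀ g, rng (inv g) = src g
  inv_mul_self : ∀ g, mul (inv g) g = src g
  mul_inv_self : ∀ g, mul g (inv g) = rng g

namespace ArrowGroupoid

/-- The unit space `𝒢⁽⁰⁾`, a subset of `𝒢`; as a type it carries the relative topology. -/
def unitSpace (G : Type*) [ArrowGroupoid G] : Set G := {x | src x = x}

section algebra

variable {G : Type*} [ArrowGroupoid G]

theorem src_src (g : G) : src (src g) = src g := by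
  have h := src_rng (src g)
  rwa [rng_src] at h

/-- The source map `s : 𝒢 → 𝒢⁽⁰⁾`. -/
def srcMap (g : G) : unitSpace G := ⟨src g, src_src g⟩

/-- The range map `r : 𝒢 → 𝒢⁽⁰⁾`. -/
def rngMap (g : G) : unitSpace G := ⟨rng g, src_rng g⟩

/-- The source fibre `𝒢ₓ = s⁻¹(x)`. -/
abbrev SrcFiber (x : unitSpace G) : Type _ := {g : G // src g = x.1}

/-- The range fibre `𝒢ᵘ = r⁻¹(u)`. -/
abbrev RngFiber (u : G) : Type _ := {h : G // rng h = u}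

/-- The unit `x` as an element of `𝒢ₓ`. -/
def unitPt (x : unitSpace G) : SrcFiber x := ⟨x.1, x.2⟩

/-- For `g ∈ 𝒢ₓ` and `h ∈ 𝒢^{r(g)}`, the element `h⁻¹g ∈ 𝒢ₓ`. -/
def leftDiv {x : unitSpace G} (g : SrcFiber x) (h : RngFiber (rng g.1)) : SrcFiber x :=
  ⟨mul (inv h.1) g.1, by rw [src_mul _ _ (by rw [src_inv, h.2]), g.2]⟩

/-- The function `g ↦ ∑_{h ∈ 𝒢^{r(g)}} f(h) ξ(h⁻¹g)` on `𝒢ₓ`. -/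
noncomputable def convVec (f : G → ℂ) {x : unitSpace G} (ξ : SrcFiber x → ℂ) : SrcFiber x → ℂ :=
  fun g => ∑' h : RngFiber (rng g.1), f h.1 * ξ (leftDiv g h)

/-- The Hilbert space `ℓ²(𝒢ₓ)`. -/
abbrev L2Fiber (x : unitSpace G) : Type _ := lp (fun _ : SrcFiber x => ℂ) 2

/-- The basis vector `δ_g ∈ ℓ²(𝒢ₓ)`. -/
noncomputable def delta {x : unitSpace G} (g : SrcFiber x) : L2Fiber x := by
  classical exact lp.single 2 g (1 : ℂ)

/-! Boundedness of the operators `ξ ↦ convVec f ξ` for `f ∈ C_c(𝒢)`, uniformly in the unit. -/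

/-- Auxiliary: `f` has finite support on range fibres and acts boundedly, with a bound that does
not depend on the unit. -/
def Nice (f : G → ℂ) : Prop :=
  (∀ u, (Function.support fun h : RngFiber u => f h.1).Finite) ∧
  ∃ C : ℝ, 0 ≤ C ∧ ∀ (x : unitSpace G) (ξ : L2Fiber x),
    ∃ η : L2Fiber x, (η : SrcFiber x → ℂ) = convVec f ξ ∧ ‖η‖ ≤ C * ‖ξ‖

theorem Nice.summable {f : G → ℂ} (hf : Nice f) {x : unitSpace G} (ξ : SrcFiber x → ℂ)
    (g : SrcFiber x) :
    Summable fun h : RngFiber (rng g.1) => f h.1 * ξ (leftDiv g h) :=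
  summable_of_hasFiniteSupport <| (hf.1 _).subset fun h hh => by
    simp only [Function.mem_support] at hh ⊢
    exact left_ne_zero_of_mul hh

theorem Nice.convVec_add {f f' : G → ℂ} (hf : Nice f) (hf' : Nice f') {x : unitSpace G}
    (ξ : SrcFiber x → ℂ) : convVec (f + f') ξ = convVec f ξ + convVec f' ξ := by
  funext g
  simp only [convVec, Pi.add_apply, add_mul]
  exact (hf.summable ξ g).tsum_add (hf'.summable ξ g)

theorem convVec_smul (c : ℂ) (f : G → ℂ) {x : unitSpace G}
    (ξ : SrcFiber x → ℂ) : convVec (c • f) ξ = c • convVec f ξ := by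
  funext g
  simp only [convVec, Pi.smul_apply, smul_eq_mul, mul_assoc]
  exact tsum_mul_left

theorem Nice.convVec_add_right {f : G → ℂ} (hf : Nice f) {x : unitSpace G}
    (ξ η : SrcFiber x → ℂ) : convVec f (ξ + η) = convVec f ξ + convVec f η := by
  funext g
  simp only [convVec, Pi.add_apply, mul_add]
  exact (hf.summable ξ g).tsum_add (hf.summable η g)

theorem convVec_smul_right (f : G → ℂ) (c : ℂ) {x : unitSpace G}
    (ξ : SrcFiber x → ℂ) : convVec f (c • ξ) = c • convVec f ξ := by
  funext g
  simp only [convVec, Pi.smul_apply, smul_eq_mul, mul_left_comm _ c]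
  exact tsum_mul_left

theorem Nice.zero : Nice (0 : G → ℂ) := by
  refine ⟨fun u => by simp, 0, le_rfl, fun x ξ => ⟨0, ?_, by simp⟩⟩
  funext g
  simp [convVec]

theorem Nice.add {f f' : G → ℂ} (hf : Nice f) (hf' : Nice f') : Nice (f + f') := by
  obtain ⟨C, hC, H⟩ := hf.2
  obtain ⟨C', hC', H'⟩ := hf'.2
  refine ⟨fun u => ((hf.1 u).union (hf'.1 u)).subset ?_, C + C', by positivity, fun x ξ => ?_⟩
  · exact Function.support_add (fun h : RngFiber u => f h.1) (fun h : RngFiber u => f' h.1)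
  · obtain ⟨η, h1, h2⟩ := H x ξ
    obtain ⟨η', h1', h2'⟩ := H' x ξ
    refine ⟨η + η', ?_, ?_⟩
    · rw [hf.convVec_add hf', ← h1, ← h1']; rfl
    · calc ‖η + η'‖ ≤ ‖η‖ + ‖η'‖ := norm_add_le _ _
        _ ≤ (C + C') * ‖ξ‖ := by linarith

theorem Nice.smul {f : G → ℂ} (hf : Nice f) (c : ℂ) : Nice (c • f) := by
  obtain ⟨C, hC, H⟩ := hf.2
  refine ⟨fun u => (hf.1 u).subset fun h hh => ?_, ‖c‖ * C, by positivity, fun x ξ => ?_⟩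
  · simp only [Function.mem_support, Pi.smul_apply, smul_eq_mul] at hh ⊢
    exact right_ne_zero_of_mul hh
  · obtain ⟨η, h1, h2⟩ := H x ξ
    refine ⟨c • η, ?_, ?_⟩
    · rw [convVec_smul, ← h1]; rfl
    · rw [norm_smul, mul_assoc]
      gcongr

theorem mul_leftDiv {x : unitSpace G} (g : SrcFiber x) (h : RngFiber (rng g.1)) :
    mul h.1 (leftDiv g h).1 = g.1 := by
  have h1 : src h.1 = rng (inv h.1) := (rng_inv _).symm
  have h2 : src (inv h.1) = rng g.1 := by rw [src_inv, h.2]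
  rw [leftDiv, ← assoc _ _ _ h1 h2, mul_inv_self, h.2, rng_mul_self]

theorem rng_leftDiv {x : unitSpace G} (g : SrcFiber x) (h : RngFiber (rng g.1)) :
    rng (leftDiv g h).1 = src h.1 := by
  rw [leftDiv, rng_mul _ _ (by rw [src_inv, h.2]), rng_inv]

theorem nice_of_bisection {f : G → ℂ} {A : Set G} (hs : Set.InjOn src A) (hr : Set.InjOn rng A)
    {M : ℝ} (hM : ∀ g, ‖f g‖ ≤ M) (hA : ∀ g, g ∉ A → f g = 0) : Nice f := by
  classical
  have hsub : ∀ u (h h' : RngFiber u), h.1 ∈ A → h'.1 ∈ A → h = h' := fun u h h' m m' =>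
    Subtype.ext (hr m m' (h.2.trans h'.2.symm))
  rcases isEmpty_or_nonempty G with hG | ⟨⟨g₀⟩⟩
  · refine ⟨fun u => (hG.false u).elim, 0, le_rfl, fun x => (hG.false x.1).elim⟩
  have hM0 : 0 ≤ M := (norm_nonneg _).trans (hM g₀)
  refine ⟨fun u => ?_, M, hM0, fun x ξ => ?_⟩
  · refine Set.Subsingleton.finite fun h hh h' hh' => hsub u h h' ?_ ?_
    · by_contra hc; exact hh (hA _ hc)
    · by_contra hc; exact hh' (hA _ hc)
  · have hp : (0 : ℝ) < (2 : ENNReal).toReal := by norm_num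
    have key : ∀ s : Finset (SrcFiber x),
        ∑ g ∈ s, ‖convVec f ξ g‖ ^ (2 : ENNReal).toReal
          ≤ (M * ‖ξ‖) ^ (2 : ENNReal).toReal := by
      intro s
      let P : SrcFiber x → Prop := fun g => ∃ h : RngFiber (rng g.1), h.1 ∈ A
      let e : SrcFiber x → SrcFiber x := fun g => if hg : P g then leftDiv g hg.choose else g
      have he : ∀ g (hg : P g), e g = leftDiv g hg.choose := fun g hg => dif_pos hg
      have hval : ∀ g, P g → ‖convVec f ξ g‖ ≤ M * ‖ξ (e g)‖ := by
        intro g hg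
        have : convVec f ξ g = f hg.choose.1 * ξ (leftDiv g hg.choose) := by
          refine tsum_eq_single hg.choose fun h hne => ?_
          rw [hA h.1 fun hm => hne (hsub _ _ _ hm hg.choose_spec), zero_mul]
        rw [this, he g hg, norm_mul]
        gcongr
        exact hM _
      have hval0 : ∀ g, ¬ P g → convVec f ξ g = 0 := by
        intro g hg
        have : ∀ h : RngFiber (rng g.1), f h.1 * ξ (leftDiv g h) = 0 := fun h => by
          rw [hA h.1 fun hm => hg ⟨h, hm⟩, zero_mul]
        simp only [convVec, this, tsum_zero]
      have hinj : Set.InjOn e (s.filter P : Finset (SrcFiber x)) := by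
        intro g hg g' hg' hee
        have hgP : P g := (Finset.mem_filter.1 hg).2
        have hgP' : P g' := (Finset.mem_filter.1 hg').2
        rw [he g hgP, he g' hgP'] at hee
        have hh : hgP.choose.1 = hgP'.choose.1 := by
          refine hs hgP.choose_spec hgP'.choose_spec ?_
          rw [← rng_leftDiv g, ← rng_leftDiv g', hee]
        apply Subtype.ext
        rw [← mul_leftDiv g hgP.choose, ← mul_leftDiv g' hgP'.choose, hee, hh]
      calc ∑ g ∈ s, ‖convVec f ξ g‖ ^ (2 : ENNReal).toReal
          = ∑ g ∈ s.filter P, ‖convVec f ξ g‖ ^ (2 : ENNReal).toReal := by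
            refine (Finset.sum_filter_of_ne fun g _ hne => ?_).symm
            by_contra hc
            exact hne (by rw [hval0 g hc, norm_zero, Real.zero_rpow hp.ne'])
        _ ≤ ∑ g ∈ s.filter P, (M * ‖ξ (e g)‖) ^ (2 : ENNReal).toReal := by
            refine Finset.sum_le_sum fun g hg => ?_
            exact Real.rpow_le_rpow (norm_nonneg _) (hval g (Finset.mem_filter.1 hg).2) hp.le
        _ = M ^ (2 : ENNReal).toReal *
              ∑ g ∈ s.filter P, ‖ξ (e g)‖ ^ (2 : ENNReal).toReal := by
            rw [Finset.mul_sum]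
            refine Finset.sum_congr rfl fun g _ => ?_
            rw [Real.mul_rpow hM0 (norm_nonneg _)]
        _ = M ^ (2 : ENNReal).toReal *
              ∑ k ∈ (s.filter P).image e, ‖ξ k‖ ^ (2 : ENNReal).toReal := by
            rw [Finset.sum_image hinj]
        _ ≤ M ^ (2 : ENNReal).toReal * ‖ξ‖ ^ (2 : ENNReal).toReal := by
            gcongr
            exact lp.sum_rpow_le_norm_rpow hp ξ _
        _ = (M * ‖ξ‖) ^ (2 : ENNReal).toReal := by
            rw [Real.mul_rpow hM0 (norm_nonneg _)]
    exact ⟨⟨convVec f ξ, memℓp_gen' key⟩, rfl,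
      lp.norm_le_of_forall_sum_le hp (by positivity) key⟩

end algebra

/-- A locally compact, not necessarily Hausdorff, étale groupoid. -/
class IsEtale (G : Type*) [TopologicalSpace G] [ArrowGroupoid G] : Prop where
  locallyCompact : LocallyCompactSpace G
  continuousOn_mul : ContinuousOn (fun p : G × G => mul p.1 p.2) {p | src p.1 = rng p.2}
  continuous_inv : Continuous (inv : G → G)
  t2_unitSpace : T2Space (unitSpace G)
  locallyCompact_unitSpace : LocallyCompactSpace (unitSpace G)
  isLocalHomeomorph_src : IsLocalHomeomorph (srcMap : G → unitSpace G)
  isLocalHomeomorph_rng : IsLocalHomeomorph (rngMap : G → unitSpace G)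

section topology

variable {G : Type*} [TopologicalSpace G] [ArrowGroupoid G]

/-- An open bisection: an open set on which the source and range maps are injective. -/
def IsOpenBisection (U : Set G) : Prop :=
  IsOpen U ∧ Set.InjOn src U ∧ Set.InjOn rng U

variable (G) in
/-- The space `C_c(𝒢)`: the span of the extensions by zero of continuous compactly supported
functions on open Hausdorff subsets `V` of `𝒢`. -/
def Cc : Submodule ℂ (G → ℂ) :=
  Submodule.span ℂ {f | ∃ V : Set G, IsOpen V ∧ T2Space V ∧
    ∃ φ : CompactlySupportedContinuousMap V ℂ, f = Function.extend Subtype.val φ 0}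

theorem nice_of_finite_cover {ι : Type*} (W : ι → Set G) (hW : ∀ i, IsOpenBisection (W i))
    (t : Finset ι) : ∀ (f : G → ℂ) (M : ℝ), (∀ g, ‖f g‖ ≤ M) →
      (∀ g, g ∉ ⋃ i ∈ t, W i → f g = 0) → Nice f := by
  classical
  induction t using Finset.induction_on with
  | empty =>
    intro f M _ h0
    have : f = 0 := funext fun g => h0 g (by simp)
    rw [this]
    exact Nice.zero
  | insert a t _ ih =>
    intro f M hM h0
    have hM' : ∀ (S : Set G) g, ‖S.indicator f g‖ ≤ M := fun S g =>
      (norm_indicator_le_norm_self f g).trans (hM g)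
    have h1 : Nice ((W a).indicator f) :=
      nice_of_bisection (hW a).2.1 (hW a).2.2 (hM' _) fun g hg => Set.indicator_of_notMem hg f
    have h2 : Nice ((W a)ᶜ.indicator f) := by
      refine ih _ M (hM' _) fun g hg => ?_
      by_cases hga : g ∈ W a
      · exact Set.indicator_of_notMem (fun h => absurd hga h) f
      · rw [Set.indicator_of_mem (show g ∈ (W a)ᶜ from hga)]
        refine h0 g ?_
        simp only [Finset.set_biUnion_insert, Set.mem_union, not_or]
        exact ⟨hga, hg⟩
    rw [← Set.indicator_self_add_compl (W a) f]
    exact h1.add h2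

theorem exists_openBisection [IsEtale G] (g : G) : ∃ U : Set G, IsOpenBisection U ∧ g ∈ U := by
  obtain ⟨e, he, hes⟩ := (IsEtale.isLocalHomeomorph_src (G := G)) g
  obtain ⟨e', he', hes'⟩ := (IsEtale.isLocalHomeomorph_rng (G := G)) g
  refine ⟨e.source ∩ e'.source, ⟨e.open_source.inter e'.open_source, ?_, ?_⟩, he, he'⟩
  · intro a ha b hb hab
    refine e.injOn ha.1 hb.1 ?_
    rw [← hes]
    exact Subtype.ext hab
  · intro a ha b hb hab
    refine e'.injOn ha.2 hb.2 ?_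
    rw [← hes']
    exact Subtype.ext hab

theorem nice_of_mem_Cc [IsEtale G] {f : G → ℂ} (hf : f ∈ Cc G) : Nice f := by
  classical
  induction hf using Submodule.span_induction with
  | zero => exact Nice.zero
  | add f f' _ _ h h' => exact h.add h'
  | smul c f _ h => exact h.smul c
  | mem f hf =>
    obtain ⟨V, _, _, φ, rfl⟩ := hf
    choose W hW hgW using fun g : G => exists_openBisection g
    have hK : IsCompact ((Subtype.val : V → G) '' tsupport φ) :=
      IsCompact.image φ.hasCompactSupport continuous_subtype_val
    obtain ⟨t, ht⟩ := hK.elim_finite_subcover W (fun i => (hW i).1)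
      fun g _ => Set.mem_iUnion.2 ⟨g, hgW g⟩
    obtain ⟨M, hM⟩ := φ.hasCompactSupport.exists_bound_of_continuous φ.continuous
    refine nice_of_finite_cover W hW t _ (max M 0) (fun g => ?_) fun g hg => ?_
    · by_cases hgV : g ∈ V
      · have := Subtype.val_injective.extend_apply φ 0 (⟨g, hgV⟩ : V)
        simp only at this
        rw [this]
        exact (hM _).trans (le_max_left _ _)
      · rw [Function.extend_apply' _ _ _ (by rintro ⟨v, rfl⟩; exact hgV v.2)]
        simp
    · by_cases hgV : g ∈ V
      · have := Subtype.val_injective.extend_apply φ 0 (⟨g, hgV⟩ : V)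
        simp only at this
        rw [this]
        by_contra hne
        exact hg (ht ⟨⟨g, hgV⟩, subset_tsupport _ hne, rfl⟩)
      · rw [Function.extend_apply' _ _ _ (by rintro ⟨v, rfl⟩; exact hgV v.2)]
        simp

/-! The representations `ρₓ` and the reduced norm. -/

variable (G) in
/-- A copy of `C_c(𝒢)`, to be equipped with the reduced norm (and not with the topology of
pointwise convergence). -/
def CcRed : Type _ := Cc G

noncomputable instance : AddCommGroup (CcRed G) := inferInstanceAs (AddCommGroup (Cc G))

noncomputable instance : Module ℂ (CcRed G) := inferInstanceAs (Module ℂ (Cc G))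

/-- The function on `𝒢` underlying an element of `C_c(𝒢)`. -/
def CcRed.toFun (f : CcRed G) : G → ℂ := Subtype.val (p := fun f => f ∈ Cc G) f

variable [IsEtale G]

theorem CcRed.nice (f : CcRed G) : Nice f.toFun :=
  nice_of_mem_Cc (Subtype.prop (p := fun f => f ∈ Cc G) f)

theorem CcRed.memLp (f : CcRed G) (x : unitSpace G) (ξ : L2Fiber x) :
    Memℓp (convVec f.toFun ξ) 2 := by
  obtain ⟨C, _, H⟩ := f.nice.2
  obtain ⟨η, h1, _⟩ := H x ξ
  rw [← h1]
  exact lp.memℓp η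

theorem CcRed.exists_bound (f : CcRed G) : ∃ C : ℝ, 0 ≤ C ∧ ∀ (x : unitSpace G) (ξ : L2Fiber x),
    ‖(⟨convVec f.toFun ξ, f.memLp x ξ⟩ : L2Fiber x)‖ ≤ C * ‖ξ‖ := by
  obtain ⟨C, hC, H⟩ := f.nice.2
  refine ⟨C, hC, fun x ξ => ?_⟩
  obtain ⟨η, h1, h2⟩ := H x ξ
  have : (⟨convVec f.toFun ξ, f.memLp x ξ⟩ : L2Fiber x) = η := Subtype.ext h1.symm
  rwa [this]

/-- The operator `ρₓ(f)` on `ℓ²(𝒢ₓ)`, for `f ∈ C_c(𝒢)`: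
`(ρₓ(f)ξ)(g) = ∑_{h ∈ 𝒢^{r(g)}} f(h) ξ(h⁻¹g)`. -/
noncomputable def rhoOp (x : unitSpace G) (f : CcRed G) : L2Fiber x →L[ℂ] L2Fiber x :=
  LinearMap.mkContinuousOfExistsBound
    { toFun := fun ξ => ⟨convVec f.toFun ξ, f.memLp x ξ⟩
      map_add' := fun ξ η => Subtype.ext (f.nice.convVec_add_right ξ η)
      map_smul' := fun c ξ => Subtype.ext (convVec_smul_right f.toFun c ξ) }
    (f.exists_bound.imp fun _ hC => hC.2 x)

theorem rhoOp_apply (x : unitSpace G) (f : CcRed G) (ξ : L2Fiber x) (g : SrcFiber x) :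
    rhoOp x f ξ g = ∑' h : RngFiber (rng g.1), f.toFun h.1 * ξ (leftDiv g h) := rfl

/-- `f ↦ ρₓ(f)` as a linear map. -/
noncomputable def rhoLin (x : unitSpace G) : CcRed G →ₗ[ℂ] (L2Fiber x →L[ℂ] L2Fiber x) where
  toFun := rhoOp x
  map_add' f f' := ContinuousLinearMap.ext fun ξ =>
    Subtype.ext (f.nice.convVec_add f'.nice ξ)
  map_smul' c f := ContinuousLinearMap.ext fun ξ => Subtype.ext (convVec_smul c f.toFun ξ)

theorem bddAbove_rho (f : CcRed G) :
    BddAbove (Set.range fun x : unitSpace G => ‖rhoLin x f‖) := by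
  obtain ⟨C, hC, H⟩ := f.exists_bound
  refine ⟨C, ?_⟩
  rintro _ ⟨x, rfl⟩
  exact ContinuousLinearMap.opNorm_le_bound _ hC (H x)

/-- The reduced norm `‖f‖ᵣ = sup_{x ∈ 𝒢⁽⁰⁾} ‖ρₓ(f)‖`. -/
noncomputable instance : Norm (CcRed G) := ⟨fun f => ⨆ x : unitSpace G, ‖rhoLin x f‖⟩

theorem norm_rhoLin_le (x : unitSpace G) (f : CcRed G) : ‖rhoLin x f‖ ≤ ‖f‖ :=
  le_ciSup (bddAbove_rho f) x

theorem redNorm_core : SeminormedSpace.Core ℂ (CcRed G) where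
  norm_nonneg f := Real.iSup_nonneg fun x => norm_nonneg _
  norm_smul c f := by
    change (⨆ x : unitSpace G, ‖rhoLin x (c • f)‖) = ‖c‖ * ⨆ x : unitSpace G, ‖rhoLin x f‖
    rw [Real.mul_iSup_of_nonneg (norm_nonneg c)]
    exact iSup_congr fun x => by rw [map_smul, norm_smul]
  norm_triangle f f' := by
    refine Real.iSup_le (fun x => ?_) (add_nonneg (Real.iSup_nonneg fun x => norm_nonneg _)
      (Real.iSup_nonneg fun x => norm_nonneg _))
    rw [map_add]
    exact (norm_add_le _ _).trans (add_le_add (norm_rhoLin_le x f) (norm_rhoLin_le x f'))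

noncomputable instance : SeminormedAddCommGroup (CcRed G) :=
  SeminormedAddCommGroup.ofCore redNorm_core

noncomputable instance : NormedSpace ℂ (CcRed G) where
  norm_smul_le c f := (redNorm_core.norm_smul c f).le

variable (G) in
/-- (The Banach space underlying) the reduced C*-algebra `C*ᵣ(𝒢)`: the completion of `C_c(𝒢)` with
respect to the reduced norm. -/
abbrev CStarRed : Type _ := UniformSpace.Completion (CcRed G)

/-- `ρₓ` on `C_c(𝒢)` as a bounded map for the reduced norm. -/
noncomputable def rhoCc (x : unitSpace G) : CcRed G →L[ℂ] (L2Fiber x →L[ℂ] L2Fiber x) :=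
  (rhoLin x).mkContinuous 1 fun f => by rw [one_mul]; exact norm_rhoLin_le x f

/-- The representation `ρₓ` of `C*ᵣ(𝒢)`: the continuous extension of `ρₓ` from `C_c(𝒢)`. -/
noncomputable def rho (x : unitSpace G) : CStarRed G →L[ℂ] (L2Fiber x →L[ℂ] L2Fiber x) :=
  (rhoCc x).extend UniformSpace.Completion.toComplL

/-- `rho x` does extend the map given by the defining formula on `C_c(𝒢)`. -/
theorem rho_coe (x : unitSpace G) (f : CcRed G) : rho x (f : CStarRed G) = rhoOp x f :=
  ContinuousLinearMap.extend_eq (rhoCc x) (e := UniformSpace.Completion.toComplL)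
    UniformSpace.Completion.denseRange_coe
    (UniformSpace.Completion.isUniformInducing_coe _) f

variable (G) in
/-- The singular ideal: all `a` such that `ρₓ(a)δₓ ≠ 0` only for a meager set of units `x`. -/
def singularIdeal : Set (CStarRed G) :=
  {a | IsMeagre {x : unitSpace G | rho x a (delta (unitPt x)) ≠ 0}}

end topology

/-- The set `D₀` of units `x` for which there are finitely many elements `g₁, …, gₙ ≠ x` of the
isotropy group at `x`, open bisections `Wₖ ∋ gₖ` and an open neighbourhood `U` of `x` in `𝒢⁽⁰⁾`
such that `U \ (W₁ ∪ … ∪ Wₙ)` has empty interior. -/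
def extremelyDangerous (G : Type*) [TopologicalSpace G] [ArrowGroupoid G] : Set (unitSpace G) :=
  {x | ∃ (n : ℕ) (g : Fin n → G) (W : Fin n → Set G) (U : Set (unitSpace G)),
    (∀ k, src (g k) = x.1 ∧ rng (g k) = x.1 ∧ g k ≠ x.1) ∧
    (∀ k, IsOpenBisection (W k) ∧ g k ∈ W k) ∧
    IsOpen U ∧ x ∈ U ∧ interior (U \ ⋃ k, Subtype.val ⁻¹' W k) = ∅}

end ArrowGroupoid

/-!
Write `â(g) = (ρ_{s(g)}(a)δ_{s(g)})(g)`. The matrix coefficients of `ρₓ(a)` are the numbers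
`â(gh⁻¹)` with `g, h ∈ 𝒢ₓ`, so `ρₓ(a) ≠ 0` exactly when `ρ_y(a)δ_y ≠ 0` for some `y` in the orbit
of `x`.

A function in `C_c(𝒢)` can be discontinuous at `g` only because of arrows `g' ≠ g` with the same
source and range as `g`, which need not be separated from `g`: it becomes continuous at `g` once
finitely many bisections through such arrows are removed. Hence if `â(g) ≠ 0`, then `â ≠ 0` near
`g` off finitely many such bisections `W`. With a bisection `A ∋ g`, the bisections `A⁻¹W` pass
through nontrivial elements of the isotropy group at `x = s(g)`, so if `x ∉ D₀`, they leave out a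
nonempty open set of units `z` near `x`, and `ρ_z(a)δ_z ≠ 0` there. Since `D₀` is invariant, any
`a` with `ρ_y(a) ≠ 0` for some `y ∉ D₀` thus has `ρ_z(a)δ_z ≠ 0` on a nonempty open set, and as
soon as `D₀` is meager everything follows from the Baire category theorem.
-/

open Filter Topology

namespace ArrowGroupoid

section Algebra

variable {G : Type*} [ArrowGroupoid G]

theorem rng_of_src_eq_self {x : G} (hx : src x = x) : rng x = x := by
  rw [← hx, rng_src]

theorem inv_of_src_eq_self {x : G} (hx : src x = x) : inv x = x := by
  have h := mul_src (inv x)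
  rwa [src_inv, rng_of_src_eq_self hx, inv_mul_self, hx, eq_comm] at h

theorem mul_inv_src (g : G) : mul g (inv (src g)) = g := by
  rw [inv_of_src_eq_self (src_src g), mul_src]

theorem inv_mul_rng (g : G) : mul (inv g) (rng g) = inv g := by
  rw [← src_inv, mul_src]

theorem mul_inv_mul_cancel {g h : G} (e : src g = src h) : mul (mul g (inv h)) h = g := by
  rw [assoc _ _ _ (by rw [rng_inv, e]) (src_inv h), inv_mul_self, ← e, mul_src]

theorem mul_mul_inv_cancel {g h : G} (e : src g = rng h) : mul (mul g h) (inv h) = g := by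
  rw [assoc _ _ _ e (rng_inv h).symm, mul_inv_self, ← e, mul_src]

theorem inv_mul_mul_cancel {g h : G} (e : src g = rng h) : mul (inv g) (mul g h) = h := by
  rw [← assoc _ _ _ (src_inv g) e, inv_mul_self, e, rng_mul_self]

theorem mul_inv_mul_mul_cancel {g h : G} (e : rng g = rng h) : mul g (mul (inv g) h) = h := by
  rw [← assoc _ _ _ (rng_inv g).symm (by rw [src_inv, e]), mul_inv_self, e, rng_mul_self]

theorem mul_left_cancel_of_composable {g h k : G} (eh : src g = rng h) (ek : src g = rng k)
    (e : mul g h = mul g k) : h = k := by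
  rw [← inv_mul_mul_cancel eh, e, inv_mul_mul_cancel ek]

theorem mul_right_cancel_of_composable {g h k : G} (eg : src g = rng k) (eh : src h = rng k)
    (e : mul g k = mul h k) : g = h := by
  rw [← mul_mul_inv_cancel eg, e, mul_mul_inv_cancel eh]

theorem inv_inv_eq (g : G) : inv (inv g) = g := by
  have h := inv_mul_mul_cancel (src_inv g)
  rwa [inv_mul_self, ← rng_inv g, ← src_inv (inv g), mul_src] at h

theorem inv_injective : Function.Injective (inv : G → G) :=
  Function.LeftInverse.injective inv_inv_eq

theorem leftDiv_eq_iff {x : unitSpace G} (g h : SrcFiber x) (k : RngFiber (rng g.1)) :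
    leftDiv g k = h ↔ k.1 = mul g.1 (inv h.1) := by
  have hgh : src g.1 = src h.1 := g.2.trans h.2.symm
  constructor
  · rintro rfl
    rw [← mul_mul_inv_cancel (rng_leftDiv g k).symm, mul_leftDiv]
  · intro e
    have hk : src k.1 = rng h.1 := by
      rw [e, src_mul _ _ (by rw [rng_inv, hgh]), src_inv]
    refine Subtype.ext (mul_left_cancel_of_composable (rng_leftDiv g k).symm hk ?_)
    rw [mul_leftDiv, e, mul_inv_mul_cancel hgh]

theorem norm_delta {x : unitSpace G} (h : SrcFiber x) : ‖delta h‖ = 1 := by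
  classical
  rw [delta, lp.norm_single two_pos, norm_one]

theorem convVec_delta (f : G → ℂ) {x : unitSpace G} (g h : SrcFiber x) :
    convVec f (delta h) g = f (mul g.1 (inv h.1)) := by
  classical
  have hgh : src g.1 = rng (inv h.1) := by rw [rng_inv, g.2, h.2]
  let k₀ : RngFiber (rng g.1) := ⟨mul g.1 (inv h.1), rng_mul _ _ hgh⟩
  have delta_eq_one : delta h (leftDiv g k₀) = 1 := by
    rw [(leftDiv_eq_iff g h k₀).2 rfl, delta, lp.single_apply_self]
  have delta_eq_zero (k : RngFiber (rng g.1)) (hk : k ≠ k₀) : delta h (leftDiv g k) = 0 := by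
    rw [delta, lp.single_apply_ne]
    exact fun e => hk (Subtype.ext ((leftDiv_eq_iff g h k).1 e))
  calc convVec f (delta h) g = f k₀.1 * delta h (leftDiv g k₀) :=
        tsum_eq_single k₀ fun k hk => by rw [delta_eq_zero k hk, mul_zero]
    _ = f (mul g.1 (inv h.1)) := by rw [delta_eq_one, mul_one]

theorem eq_zero_of_forall_delta {x : unitSpace G} {T : L2Fiber x →L[ℂ] L2Fiber x}
    (hT : ∀ h, T (delta h) = 0) : T = 0 := by
  classical
  refine lp.ext_continuousLinearMap ENNReal.ofNat_ne_top fun h => ContinuousLinearMap.ext_ring ?_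
  have hsingle : lp.single 2 h (1 : ℂ) = delta h := by rw [delta]
  simpa [hsingle] using hT h

/-- The product `AB` of sets of arrows: all products of composable pairs in `A × B`. -/
def composableProduct (A B : Set G) : Set G :=
  {m | ∃ a ∈ A, ∃ b ∈ B, src a = rng b ∧ mul a b = m}

theorem mul_mem_composableProduct {A B : Set G} {a b : G} (ha : a ∈ A) (hb : b ∈ B)
    (e : src a = rng b) : mul a b ∈ composableProduct A B :=
  ⟨a, ha, b, hb, e, rfl⟩

theorem injOn_src_composableProduct {A B : Set G} (hA : A.InjOn src) (hB : B.InjOn src) :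
    (composableProduct A B).InjOn src := by
  rintro _ ⟨a, ha, b, hb, e, rfl⟩ _ ⟨a', ha', b', hb', e', rfl⟩ hs
  rw [src_mul _ _ e, src_mul _ _ e'] at hs
  obtain rfl := hB hb hb' hs
  rw [hA ha ha' (e.trans e'.symm)]

theorem injOn_rng_composableProduct {A B : Set G} (hA : A.InjOn rng) (hB : B.InjOn rng) :
    (composableProduct A B).InjOn rng := by
  rintro _ ⟨a, ha, b, hb, e, rfl⟩ _ ⟨a', ha', b', hb', e', rfl⟩ hr
  rw [rng_mul _ _ e, rng_mul _ _ e'] at hr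
  obtain rfl := hA ha ha' hr
  rw [hB hb hb' (e.symm.trans e')]

end Algebra

section Bisections

variable {G : Type*} [TopologicalSpace G] [ArrowGroupoid G] [IsEtale G]

theorem continuous_srcMap : Continuous (srcMap : G → unitSpace G) :=
  IsEtale.isLocalHomeomorph_src.continuous

theorem continuous_rngMap : Continuous (rngMap : G → unitSpace G) :=
  IsEtale.isLocalHomeomorph_rng.continuous

theorem map_srcMap_nhds (g : G) : map srcMap (𝓝 g) = 𝓝 (srcMap g) :=
  IsEtale.isLocalHomeomorph_src.map_nhds_eq g

theorem continuousAt_mul_of_composable {X : Type*} [TopologicalSpace X] {u v : X → G} {x : X}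
    (hu : ContinuousAt u x) (hv : ContinuousAt v x) (h : ∀ᶠ z in 𝓝 x, src (u z) = rng (v z)) :
    ContinuousAt (fun z => mul (u z) (v z)) x :=
  (IsEtale.continuousOn_mul (u x, v x) h.self_of_nhds).tendsto.comp
    (tendsto_nhdsWithin_iff.2 ⟨hu.prodMk hv, h⟩)

theorem exists_rngMap_section (a : G) : ∃ τ : unitSpace G → G,
    τ (rngMap a) = a ∧ ContinuousAt τ (rngMap a) ∧ ∀ᶠ z in 𝓝 (rngMap a), rngMap (τ z) = z := by
  obtain ⟨e, ha, he⟩ := IsEtale.isLocalHomeomorph_rng (G := G) a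
  rw [he]
  exact ⟨e.symm, e.left_inv ha, e.symm.continuousAt (e.map_source ha),
    e.eventually_right_inverse (e.map_source ha)⟩

theorem isOpen_composableProduct {A B : Set G} (hA : IsOpen A) (hB : IsOpen B) :
    IsOpen (composableProduct A B) := by
  rw [isOpen_iff_mem_nhds]
  rintro _ ⟨a, ha, b, hb, hab, rfl⟩
  have hr : rngMap (mul a b) = rngMap a := Subtype.ext (rng_mul a b hab)
  obtain ⟨τ, hτa, hτ, hsec⟩ := exists_rngMap_section a
  rw [← hr] at hτa hτ hsec
  have hα : ContinuousAt (fun k => τ (rngMap k)) (mul a b) :=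
    hτ.comp_of_eq continuous_rngMap.continuousAt rfl
  have hrng : ∀ᶠ k in 𝓝 (mul a b), rng (τ (rngMap k)) = rng k :=
    (continuous_rngMap.continuousAt.eventually hsec).mono fun k hk => congrArg Subtype.val hk
  have hβ : ContinuousAt (fun k => mul (inv (τ (rngMap k))) k) (mul a b) :=
    continuousAt_mul_of_composable (IsEtale.continuous_inv.continuousAt.comp hα) continuousAt_id
      (hrng.mono fun k hk => (src_inv _).trans hk)
  have hαA : ∀ᶠ k in 𝓝 (mul a b), τ (rngMap k) ∈ A :=
    hα.eventually_mem (hA.mem_nhds (by rwa [hτa]))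
  have hβB : ∀ᶠ k in 𝓝 (mul a b), mul (inv (τ (rngMap k))) k ∈ B :=
    hβ.eventually_mem (hB.mem_nhds (by rwa [hτa, inv_mul_mul_cancel hab]))
  filter_upwards [hαA, hβB, hrng] with k hkA hkB hk
  refine ⟨_, hkA, _, hkB, ?_, mul_inv_mul_mul_cancel hk⟩
  rw [rng_mul _ _ ((src_inv _).trans hk), rng_inv]

theorem IsOpenBisection.composableProduct {A B : Set G} (hA : IsOpenBisection A)
    (hB : IsOpenBisection B) : IsOpenBisection (composableProduct A B) :=
  ⟨isOpen_composableProduct hA.1 hB.1, injOn_src_composableProduct hA.2.1 hB.2.1,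
    injOn_rng_composableProduct hA.2.2 hB.2.2⟩

theorem IsOpenBisection.preimage_inv {A : Set G} (hA : IsOpenBisection A) :
    IsOpenBisection (inv ⁻¹' A) := by
  refine ⟨hA.1.preimage IsEtale.continuous_inv, fun g hg h hh e => ?_, fun g hg h hh e => ?_⟩
  · exact inv_injective (hA.2.2 hg hh (by rwa [rng_inv, rng_inv]))
  · exact inv_injective (hA.2.1 hg hh (by rwa [src_inv, src_inv]))

end Bisections

section TwinBisections

variable {G : Type*} [TopologicalSpace G] [ArrowGroupoid G]

/-- The open bisections containing an arrow parallel to `γ` (with the same source and range) but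
different from it. For a unit `γ = x` these are the bisections through nontrivial elements of the
isotropy group at `x`, as in the definition of `D₀`. -/
def twinBisections (γ : G) : Set (Set G) :=
  {W | IsOpenBisection W ∧ ∃ g ∈ W, src g = src γ ∧ rng g = rng γ ∧ g ≠ γ}

theorem interior_sdiff_of_isOpen {X : Type*} [TopologicalSpace X] {U S : Set X} (hU : IsOpen U) :
    interior (U \ S) = U \ closure S := by
  rw [Set.sdiff_eq, interior_inter, hU.interior_eq, interior_compl, Set.sdiff_eq]

theorem mem_extremelyDangerous_iff {x : unitSpace G} :
    x ∈ extremelyDangerous G ↔ ∃ T ⊆ twinBisections x.1, T.Finite ∧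
      closure (Subtype.val ⁻¹' ⋃₀ T : Set (unitSpace G)) ∈ 𝓝 x := by
  have hsrc : src x.1 = x.1 := x.2
  have hrng : rng x.1 = x.1 := rng_of_src_eq_self x.2
  constructor
  · rintro ⟨n, g, W, U, hg, hW, hU, hxU, hint⟩
    refine ⟨Set.range W, ?_, Set.finite_range W, ?_⟩
    · rintro _ ⟨k, rfl⟩
      obtain ⟨hs, hr, hne⟩ := hg k
      exact ⟨(hW k).1, g k, (hW k).2, hs.trans hsrc.symm, hr.trans hrng.symm, hne⟩
    · rw [interior_sdiff_of_isOpen hU, Set.sdiff_eq_empty] at hint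
      rw [Set.sUnion_range, Set.preimage_iUnion]
      exact mem_of_superset (hU.mem_nhds hxU) hint
  · rintro ⟨T, hT, hfin, hx⟩
    obtain ⟨n, W, -, rfl⟩ := hfin.fin_param
    choose hW g hgW hs hr hne using fun k => hT (Set.mem_range_self k)
    refine ⟨n, g, W, _, fun k => ⟨(hs k).trans hsrc, (hr k).trans hrng, hne k⟩,
      fun k => ⟨hW k, hgW k⟩, isOpen_interior, mem_interior_iff_mem_nhds.2 hx, ?_⟩
    rw [interior_sdiff_of_isOpen isOpen_interior, ← Set.preimage_iUnion, ← Set.sUnion_range]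
    exact Set.sdiff_eq_empty.2 interior_subset

variable [IsEtale G]

theorem composableProduct_left_mem_twinBisections {A W : Set G} (hA : IsOpenBisection A) {α γ : G}
    (hα : α ∈ A) (e : src α = rng γ) (hW : W ∈ twinBisections γ) :
    composableProduct A W ∈ twinBisections (mul α γ) := by
  obtain ⟨hWb, g, hg, hs, hr, hne⟩ := hW
  have e' : src α = rng g := e.trans hr.symm
  refine ⟨hA.composableProduct hWb, mul α g, mul_mem_composableProduct hα hg e', ?_, ?_,
    fun h => hne (mul_left_cancel_of_composable e' e h)⟩
  · rw [src_mul _ _ e', src_mul _ _ e, hs]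
  · rw [rng_mul _ _ e', rng_mul _ _ e]

theorem composableProduct_right_mem_twinBisections {B W : Set G} (hB : IsOpenBisection B)
    {β γ : G} (hβ : β ∈ B) (e : src γ = rng β) (hW : W ∈ twinBisections γ) :
    composableProduct W B ∈ twinBisections (mul γ β) := by
  obtain ⟨hWb, g, hg, hs, hr, hne⟩ := hW
  have e' : src g = rng β := hs.trans e
  refine ⟨hWb.composableProduct hB, mul g β, mul_mem_composableProduct hg hβ e', ?_, ?_,
    fun h => hne (mul_right_cancel_of_composable e' e h)⟩
  · rw [src_mul _ _ e', src_mul _ _ e]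
  · rw [rng_mul _ _ e', rng_mul _ _ e, hr]

theorem leftTranslate_mem_twinBisections {A W : Set G} (hA : IsOpenBisection A) {γ : G}
    (hγ : γ ∈ A) (hW : W ∈ twinBisections γ) :
    composableProduct (inv ⁻¹' A) W ∈ twinBisections (src γ) := by
  have h := composableProduct_left_mem_twinBisections hA.preimage_inv (α := inv γ)
    (by rwa [Set.mem_preimage, inv_inv_eq]) (src_inv γ) hW
  rwa [inv_mul_self] at h

theorem conjugate_mem_twinBisections {B W : Set G} (hB : IsOpenBisection B) {h : G}
    (hh : h ∈ B) (hW : W ∈ twinBisections (rng h)) :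
    composableProduct (composableProduct (inv ⁻¹' B) W) B ∈ twinBisections (src h) := by
  have hl := composableProduct_left_mem_twinBisections hB.preimage_inv (α := inv h)
    (by rwa [Set.mem_preimage, inv_inv_eq]) (by rw [src_inv, rng_of_src_eq_self (src_rng h)]) hW
  rw [inv_mul_rng] at hl
  have hr := composableProduct_right_mem_twinBisections hB hh (src_inv h) hl
  rwa [inv_mul_self] at hr

theorem srcMap_mem_extremelyDangerous {h : G} (hh : rngMap h ∈ extremelyDangerous G) :
    srcMap h ∈ extremelyDangerous G := by
  obtain ⟨T, hT, hfin, hcl⟩ := mem_extremelyDangerous_iff.1 hh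
  obtain ⟨B, hB, hhB⟩ := exists_openBisection h
  let conj (W : Set G) : Set G := composableProduct (composableProduct (inv ⁻¹' B) W) B
  have hconj : Set.MapsTo srcMap (B ∩ rngMap ⁻¹' (Subtype.val ⁻¹' ⋃₀ T))
      (Subtype.val ⁻¹' ⋃₀ (conj '' T)) := by
    rintro b ⟨hb, W, hW, hbW⟩
    have e : src (inv b) = rng (rng b) := by rw [src_inv, rng_of_src_eq_self (src_rng b)]
    refine ⟨conj W, Set.mem_image_of_mem conj hW,
      mul (inv b) (rng b), mul_mem_composableProduct ?_ hbW e, b, hb, ?_, ?_⟩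
    · rwa [Set.mem_preimage, inv_inv_eq]
    · rw [inv_mul_rng, src_inv]
    · rw [inv_mul_rng, inv_mul_self]; rfl
  refine mem_extremelyDangerous_iff.2 ⟨conj '' T, ?_, hfin.image conj, ?_⟩
  · rintro _ ⟨W, hW, rfl⟩
    exact conjugate_mem_twinBisections hB hhB (hT hW)
  · rw [← map_srcMap_nhds, mem_map]
    filter_upwards [continuous_rngMap.continuousAt hcl, hB.1.mem_nhds hhB] with k hk hkB
    have hk' := IsEtale.isLocalHomeomorph_rng.isOpenMap.preimage_closure_subset_closure_preimage hk
    exact map_mem_closure continuous_srcMap (hB.1.inter_closure ⟨hkB, hk'⟩) hconj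

theorem eventually_mem_of_mem_inter {V W : Set G} (hV : IsOpen V) (hVs : V.InjOn src)
    (hW : IsOpen W) {g : G} (hgV : g ∈ V) (hgW : g ∈ W) :
    ∀ᶠ z : unitSpace G in 𝓝 (srcMap g), z.1 ∈ V → z.1 ∈ W := by
  have hVW : V ∩ W ∈ 𝓝 g := inter_mem (hV.mem_nhds hgV) (hW.mem_nhds hgW)
  rw [← map_srcMap_nhds]
  filter_upwards [image_mem_map hVW] with z hz hzV
  obtain ⟨w, ⟨hwV, hwW⟩, rfl⟩ := hz
  rwa [← hVs hwV hzV (src_src w).symm]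

theorem extremelyDangerous_subset_iUnion_frontier {ι : Type*} {W : ι → Set G}
    (hW : ∀ i, IsOpenBisection (W i)) (hcover : ⋃ i, W i = Set.univ) :
    extremelyDangerous G ⊆ ⋃ i, frontier (Subtype.val ⁻¹' W i) := by
  intro x hx
  obtain ⟨T, hT, hfin, hcl⟩ := mem_extremelyDangerous_iff.1 hx
  have hxcl := mem_of_mem_nhds hcl
  rw [Set.preimage_sUnion, hfin.closure_biUnion] at hxcl
  obtain ⟨V, hVT, hxV⟩ := Set.mem_iUnion₂.1 hxcl
  obtain ⟨hV, g, hgV, hgs, -, hgx⟩ := hT hVT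
  obtain ⟨i, hgi⟩ := Set.iUnion_eq_univ_iff.1 hcover g
  have hgx' : srcMap g = x := Subtype.ext (hgs.trans x.2)
  have hxi : x.1 ∉ W i := fun hxi => hgx ((hW i).2.1 hgi hxi hgs)
  refine Set.mem_iUnion.2 ⟨i, ?_, fun h => hxi (interior_subset (s := Subtype.val ⁻¹' W i) h)⟩
  have hev := eventually_mem_of_mem_inter hV.1 hV.2.1 (hW i).1 hgV hgi
  rw [hgx'] at hev
  rw [mem_closure_iff_frequently] at hxV ⊢
  exact (hxV.and_eventually hev).mono fun z hz => hz.2 hz.1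

theorem isMeagre_extremelyDangerous {ι : Type*} [Countable ι] {W : ι → Set G}
    (hW : ∀ i, IsOpenBisection (W i)) (hcover : ⋃ i, W i = Set.univ) :
    IsMeagre (extremelyDangerous G) := by
  refine (isMeagre_iUnion fun i => IsNowhereDense.isMeagre ?_).mono
    (extremelyDangerous_subset_iUnion_frontier hW hcover)
  have ho : IsOpen (Subtype.val ⁻¹' W i : Set (unitSpace G)) :=
    (hW i).1.preimage continuous_subtype_val
  rw [isClosed_frontier.isNowhereDense_iff, ← frontier_compl]
  exact interior_frontier ho.isClosed_compl

end TwinBisections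

section Continuity

variable {G : Type*} [TopologicalSpace G] [ArrowGroupoid G] [IsEtale G]

theorem disjoint_nhds_of_not_parallel {g γ : G} (h : ¬(src g = src γ ∧ rng g = rng γ)) :
    Disjoint (𝓝 g) (𝓝 γ) := by
  have : T2Space (unitSpace G) := IsEtale.t2_unitSpace
  rcases not_and_or.1 h with hs | hr
  · have hne : srcMap g ≠ srcMap γ := fun e => hs (congrArg Subtype.val e)
    exact continuous_srcMap.continuousAt.disjoint (disjoint_nhds_nhds.2 hne)
      continuous_srcMap.continuousAt
  · have hne : rngMap g ≠ rngMap γ := fun e => hr (congrArg Subtype.val e)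
    exact continuous_rngMap.continuousAt.disjoint (disjoint_nhds_nhds.2 hne)
      continuous_rngMap.continuousAt

theorem exists_twinBisections_of_isCompact {K : Set G} (hK : IsCompact K) {γ : G} (hγ : γ ∉ K) :
    ∃ T ⊆ twinBisections γ, T.Finite ∧ Kᶜ ∪ ⋃₀ T ∈ 𝓝 γ := by
  refine hK.induction_on (p := fun S => ∃ T ⊆ twinBisections γ, T.Finite ∧ Sᶜ ∪ ⋃₀ T ∈ 𝓝 γ)
    ⟨∅, Set.empty_subset _, Set.finite_empty, by simp⟩ ?_ ?_ fun k hk => ?_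
  · rintro S S' hS ⟨T, hT, hfin, h⟩
    exact ⟨T, hT, hfin, mem_of_superset h (Set.union_subset_union_left _
      (Set.compl_subset_compl.2 hS))⟩
  · rintro S S' ⟨T, hT, hfin, h⟩ ⟨T', hT', hfin', h'⟩
    refine ⟨T ∪ T', Set.union_subset hT hT', hfin.union hfin', ?_⟩
    rw [Set.sUnion_union]
    filter_upwards [h, h'] with g hg hg'
    simp only [Set.mem_union, Set.mem_compl_iff] at hg hg' ⊢
    tauto
  · by_cases hkγ : src k = src γ ∧ rng k = rng γ
    · obtain ⟨W, hW, hkW⟩ := exists_openBisection k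
      refine ⟨W, mem_nhdsWithin_of_mem_nhds (hW.1.mem_nhds hkW), {W},
        Set.singleton_subset_iff.2 ⟨hW, k, hkW, hkγ.1, hkγ.2, fun e => hγ (e ▸ hk)⟩,
        Set.finite_singleton W, ?_⟩
      rw [Set.sUnion_singleton, Set.compl_union_self]
      exact univ_mem
    · obtain ⟨U, hU, V, hV, hUV⟩ := Filter.disjoint_iff.1 (disjoint_nhds_of_not_parallel hkγ)
      exact ⟨U, mem_nhdsWithin_of_mem_nhds hU, ∅, Set.empty_subset _, Set.finite_empty,
        mem_of_superset hV (hUV.subset_compl_left.trans Set.subset_union_left)⟩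

theorem extend_eq_zero_of_notMem_tsupport {X : Type*} [TopologicalSpace X] {V : Set X}
    (φ : V → ℂ) {g : X} (hg : g ∉ Subtype.val '' tsupport φ) :
    Function.extend Subtype.val φ 0 g = 0 := by
  by_cases hgV : g ∈ V
  · have hφ : φ ⟨g, hgV⟩ = 0 := by
      by_contra hne
      exact hg ⟨⟨g, hgV⟩, subset_tsupport φ hne, rfl⟩
    exact (Subtype.val_injective.extend_apply φ 0 ⟨g, hgV⟩).trans hφ
  · exact Function.extend_apply' _ _ _ fun ⟨v, hv⟩ => hgV (hv ▸ v.2)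

theorem exists_twinBisections_continuousWithinAt_extend {V : Set G} (hV : IsOpen V)
    (φ : CompactlySupportedContinuousMap V ℂ) (γ : G) :
    ∃ T ⊆ twinBisections γ, T.Finite ∧
      ContinuousWithinAt (Function.extend Subtype.val φ 0) (⋃₀ T)ᶜ γ := by
  by_cases hγ : γ ∈ V
  · refine ⟨∅, Set.empty_subset _, Set.finite_empty, ContinuousAt.continuousWithinAt ?_⟩
    have hval := hV.isOpenEmbedding_subtypeVal
    rw [← hval.continuousAt_iff (x := ⟨γ, hγ⟩), Function.extend_comp Subtype.val_injective]
    exact φ.continuous.continuousAt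
  · have hK : IsCompact (Subtype.val '' tsupport φ) :=
      φ.hasCompactSupport.isCompact.image continuous_subtype_val
    have hγK : γ ∉ Subtype.val '' tsupport φ := fun ⟨v, _, hv⟩ => hγ (hv ▸ v.2)
    obtain ⟨T, hT, hfin, hT_nhds⟩ := exists_twinBisections_of_isCompact hK hγK
    refine ⟨T, hT, hfin, continuousWithinAt_const.congr_of_eventuallyEq ?_
      (extend_eq_zero_of_notMem_tsupport φ hγK)⟩
    filter_upwards [mem_nhdsWithin_of_mem_nhds hT_nhds, self_mem_nhdsWithin] with g hg hgT
    exact extend_eq_zero_of_notMem_tsupport φ (hg.resolve_right hgT)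

theorem exists_twinBisections_continuousWithinAt {f : G → ℂ} (hf : f ∈ Cc G) (γ : G) :
    ∃ T ⊆ twinBisections γ, T.Finite ∧ ContinuousWithinAt f (⋃₀ T)ᶜ γ := by
  induction hf using Submodule.span_induction with
  | mem f hf =>
    obtain ⟨V, hV, -, φ, rfl⟩ := hf
    exact exists_twinBisections_continuousWithinAt_extend hV φ γ
  | zero => exact ⟨∅, Set.empty_subset _, Set.finite_empty, continuousWithinAt_const⟩
  | add f f' _ _ hf hf' =>
    obtain ⟨T, hT, hfin, hc⟩ := hf
    obtain ⟨T', hT', hfin', hc'⟩ := hf'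
    refine ⟨T ∪ T', Set.union_subset hT hT', hfin.union hfin', ?_⟩
    rw [Set.sUnion_union, Set.compl_union]
    exact (hc.mono Set.inter_subset_left).add (hc'.mono Set.inter_subset_right)
  | smul c f _ hf =>
    obtain ⟨T, hT, hfin, hc⟩ := hf
    exact ⟨T, hT, hfin, hc.const_smul c⟩

end Continuity

section Coefficients

variable {G : Type*} [TopologicalSpace G] [ArrowGroupoid G] [IsEtale G]

/-- The matrix coefficient `a ↦ ⟨ρₓ(a)δ_h, δ_g⟩`. -/
noncomputable def matrixCoeff {x : unitSpace G} (g h : SrcFiber x) : CStarRed G →L[ℂ] ℂ :=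
  lp.evalCLM ℂ (fun _ : SrcFiber x => ℂ) 2 g ∘L
    ContinuousLinearMap.apply ℂ (L2Fiber x) (delta h) ∘L rho x

/-- Evaluation at an arrow: `a ↦ â(γ) = (ρ_{s(γ)}(a)δ_{s(γ)})(γ)`, which extends `f ↦ f(γ)` from
`C_c(𝒢)` to `C*ᵣ(𝒢)`. -/
noncomputable def arrowEval (γ : G) : CStarRed G →L[ℂ] ℂ :=
  matrixCoeff (x := srcMap γ) ⟨γ, rfl⟩ (unitPt (srcMap γ))

theorem matrixCoeff_apply {x : unitSpace G} (g h : SrcFiber x) (a : CStarRed G) :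
    matrixCoeff g h a = rho x a (delta h) g := rfl

theorem matrixCoeff_coe {x : unitSpace G} (g h : SrcFiber x) (f : CcRed G) :
    matrixCoeff g h (f : CStarRed G) = f.toFun (mul g.1 (inv h.1)) := by
  rw [matrixCoeff_apply, rho_coe]
  exact convVec_delta f.toFun g h

theorem arrowEval_coe (γ : G) (f : CcRed G) : arrowEval γ (f : CStarRed G) = f.toFun γ :=
  (matrixCoeff_coe _ _ f).trans (congrArg f.toFun (mul_inv_src γ))

theorem matrixCoeff_eq_arrowEval {x : unitSpace G} (g h : SrcFiber x) (a : CStarRed G) :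
    matrixCoeff g h a = arrowEval (mul g.1 (inv h.1)) a := by
  induction a using UniformSpace.Completion.induction_on with
  | hp => exact isClosed_eq (matrixCoeff g h).continuous (arrowEval _).continuous
  | ih f => rw [matrixCoeff_coe, arrowEval_coe]

theorem norm_rho_le (x : unitSpace G) (a : CStarRed G) : ‖rho x a‖ ≤ ‖a‖ := by
  induction a using UniformSpace.Completion.induction_on with
  | hp => exact isClosed_le (rho x).continuous.norm continuous_norm
  | ih f =>
    rw [rho_coe, UniformSpace.Completion.norm_coe]
    exact norm_rhoLin_le x f

theorem norm_arrowEval_le (γ : G) (a : CStarRed G) : ‖arrowEval γ a‖ ≤ ‖a‖ :=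
  calc ‖arrowEval γ a‖ ≤ ‖rho (srcMap γ) a (delta (unitPt (srcMap γ)))‖ :=
        lp.norm_apply_le_norm two_ne_zero _ _
    _ ≤ ‖rho (srcMap γ) a‖ * ‖delta (unitPt (srcMap γ))‖ := (rho _ a).le_opNorm _
    _ ≤ ‖a‖ := by rw [norm_delta, mul_one]; exact norm_rho_le _ a

theorem rho_delta_unitPt_ne_zero_iff {x : unitSpace G} {a : CStarRed G} :
    rho x a (delta (unitPt x)) ≠ 0 ↔ ∃ γ, srcMap γ = x ∧ arrowEval γ a ≠ 0 := by
  rw [← not_iff_not]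
  push Not
  constructor
  · rintro h γ rfl
    exact congrFun (congrArg Subtype.val h) _
  · refine fun h => lp.ext (funext fun ⟨γ, hγ⟩ => ?_)
    obtain rfl : srcMap γ = x := Subtype.ext hγ
    exact h γ rfl

theorem rho_ne_zero_iff {x : unitSpace G} {a : CStarRed G} :
    rho x a ≠ 0 ↔
      ∃ h : G, srcMap h = x ∧ rho (rngMap h) a (delta (unitPt (rngMap h))) ≠ 0 := by
  constructor
  · intro hx
    obtain ⟨⟨h, hh⟩, hδ⟩ : ∃ h, rho x a (delta h) ≠ 0 := by
      by_contra! hc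
      exact hx (eq_zero_of_forall_delta hc)
    obtain ⟨⟨g, hg⟩, hgh⟩ := Function.ne_iff.1 fun e => hδ (lp.ext e)
    have e : src g = rng (inv h) := by rw [rng_inv, hg, hh]
    refine ⟨h, Subtype.ext hh, rho_delta_unitPt_ne_zero_iff.2 ⟨mul g (inv h), ?_, ?_⟩⟩
    · exact Subtype.ext ((src_mul _ _ e).trans (src_inv h))
    · rwa [← matrixCoeff_eq_arrowEval ⟨g, hg⟩ ⟨h, hh⟩]
  · rintro ⟨h, rfl, hh⟩ h0
    obtain ⟨γ, hγ, hne⟩ := rho_delta_unitPt_ne_zero_iff.1 hh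
    have e : src γ = rng h := congrArg Subtype.val hγ
    have hcoeff := matrixCoeff_eq_arrowEval (x := srcMap h) ⟨mul γ h, src_mul _ _ e⟩ ⟨h, rfl⟩ a
    rw [matrixCoeff_apply, h0, mul_mul_inv_cancel e] at hcoeff
    exact hne hcoeff.symm

theorem eq_zero_of_forall_rho_eq_zero {a : CStarRed G} (ha : ∀ x, rho x a = 0) : a = 0 := by
  have norm_le_norm_sub (b : CStarRed G) : ‖b‖ ≤ ‖b - a‖ := by
    induction b using UniformSpace.Completion.induction_on with
    | hp => exact isClosed_le continuous_norm (continuous_id.sub continuous_const).norm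
    | ih f =>
      rw [UniformSpace.Completion.norm_coe]
      refine Real.iSup_le (fun x => ?_) (norm_nonneg _)
      have h := norm_rho_le x (f - a)
      rwa [map_sub, ha x, sub_zero, rho_coe] at h
  simpa using norm_le_norm_sub a

theorem exists_twinBisections_arrowEval_ne_zero {γ : G} {a : CStarRed G}
    (ha : arrowEval γ a ≠ 0) :
    ∃ T ⊆ twinBisections γ, T.Finite ∧ {g | arrowEval g a ≠ 0} ∪ ⋃₀ T ∈ 𝓝 γ := by
  obtain ⟨f, hf⟩ := UniformSpace.Completion.denseRange_coe.exists_dist_lt a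
    (half_pos (norm_pos_iff.2 ha))
  rw [dist_eq_norm] at hf
  have norm_sub_lt (g : G) : ‖arrowEval g a - f.toFun g‖ < ‖arrowEval γ a‖ / 2 := by
    rw [← arrowEval_coe, ← map_sub]
    exact (norm_arrowEval_le g _).trans_lt hf
  have hfγ : ‖arrowEval γ a‖ / 2 < ‖f.toFun γ‖ := by
    linarith [norm_sub_lt γ, norm_sub_norm_le (arrowEval γ a) (f.toFun γ)]
  obtain ⟨T, hT, hfin, hc⟩ := exists_twinBisections_continuousWithinAt
    (Subtype.prop (p := fun f => f ∈ Cc G) f) γ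
  refine ⟨T, hT, hfin, ?_⟩
  filter_upwards [eventually_nhdsWithin_iff.1 (hc.norm.eventually (lt_mem_nhds hfγ))] with g hg
  refine or_iff_not_imp_right.2 fun hgT h0 => ?_
  have h := norm_sub_lt g
  rw [h0, zero_sub, norm_neg] at h
  exact h.not_gt (hg hgT)

end Coefficients

section SingularIdeal

variable {G : Type*} [TopologicalSpace G] [ArrowGroupoid G] [IsEtale G]

theorem nonempty_interior_of_rho_delta_ne_zero {x : unitSpace G} (hx : x ∉ extremelyDangerous G)
    {a : CStarRed G} (ha : rho x a (delta (unitPt x)) ≠ 0) :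
    (interior {z : unitSpace G | rho z a (delta (unitPt z)) ≠ 0}).Nonempty := by
  obtain ⟨γ, rfl, hγ⟩ := rho_delta_unitPt_ne_zero_iff.1 ha
  obtain ⟨T, hT, hfin, hT_nhds⟩ := exists_twinBisections_arrowEval_ne_zero hγ
  obtain ⟨A, hA, hγA⟩ := exists_openBisection γ
  set T' := composableProduct (inv ⁻¹' A) '' T
  have hT' : T' ⊆ twinBisections (src γ) := by
    rintro _ ⟨W, hW, rfl⟩
    exact leftTranslate_mem_twinBisections hA hγA (hT hW)
  have hcover : closure (Subtype.val ⁻¹' ⋃₀ T') ∪ {z | rho z a (delta (unitPt z)) ≠ 0} ∈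
      𝓝 (srcMap γ) := by
    rw [← map_srcMap_nhds, mem_map]
    filter_upwards [hT_nhds, hA.1.mem_nhds hγA] with g hg hgA
    rcases hg with hg | ⟨W, hW, hgW⟩
    · exact Or.inr (rho_delta_unitPt_ne_zero_iff.2 ⟨g, rfl, hg⟩)
    · refine Or.inl (subset_closure ⟨_, Set.mem_image_of_mem _ hW, inv g, ?_, g, hgW, src_inv g,
        inv_mul_self g⟩)
      rwa [Set.mem_preimage, inv_inv_eq]
  by_contra hempty
  refine hx (mem_extremelyDangerous_iff.2 ⟨T', hT', hfin.image _, ?_⟩)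
  rwa [← mem_interior_iff_mem_nhds, interior_union_isClosed_of_interior_empty isClosed_closure
    (Set.not_nonempty_iff_eq_empty.1 hempty), mem_interior_iff_mem_nhds] at hcover

theorem nonempty_interior_of_rho_ne_zero {x : unitSpace G} (hx : x ∉ extremelyDangerous G)
    {a : CStarRed G} (ha : rho x a ≠ 0) :
    (interior {z : unitSpace G | rho z a (delta (unitPt z)) ≠ 0}).Nonempty := by
  obtain ⟨h, rfl, hh⟩ := rho_ne_zero_iff.1 ha
  exact nonempty_interior_of_rho_delta_ne_zero (mt srcMap_mem_extremelyDangerous hx) hh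

theorem baireSpace_unitSpace : BaireSpace (unitSpace G) :=
  have : T2Space (unitSpace G) := IsEtale.t2_unitSpace
  have : LocallyCompactSpace (unitSpace G) := IsEtale.locallyCompact_unitSpace
  inferInstance

theorem rho_eq_zero_of_mem_singularIdeal {a : CStarRed G} (ha : a ∈ singularIdeal G)
    {x : unitSpace G} (hx : x ∉ extremelyDangerous G) : rho x a = 0 := by
  have := baireSpace_unitSpace (G := G)
  by_contra hne
  exact not_isMeagre_of_isOpen isOpen_interior (nonempty_interior_of_rho_ne_zero hx hne)
    (IsMeagre.mono interior_subset ha)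

theorem rho_delta_eq_zero_of_rho_eq_zero {x : unitSpace G} {a : CStarRed G} (h : rho x a = 0) :
    rho x a (delta (unitPt x)) = 0 := by
  rw [h, zero_apply]

theorem singularIdeal_eq_setOf_isMeagre (hD : IsMeagre (extremelyDangerous G)) :
    singularIdeal G = {a : CStarRed G | IsMeagre {x : unitSpace G | rho x a ≠ 0}} := by
  refine Set.Subset.antisymm (fun a ha => hD.mono fun x hx => ?_) fun a ha =>
    IsMeagre.mono (fun x => mt rho_delta_eq_zero_of_rho_eq_zero) ha
  by_contra hxD
  exact hx (rho_eq_zero_of_mem_singularIdeal ha hxD)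

theorem singularIdeal_eq_iInter_ker (hD : IsMeagre (extremelyDangerous G))
    {Y : Set (unitSpace G)} (hY : Y ⊆ (extremelyDangerous G)ᶜ)
    (hYdense : (extremelyDangerous G)ᶜ ⊆ closure Y) :
    singularIdeal G = ⋂ y ∈ Y, {a : CStarRed G | rho y a = 0} := by
  have := baireSpace_unitSpace (G := G)
  have hdense : Dense Y := ((dense_of_mem_residual hD).mono hYdense).of_closure
  refine Set.Subset.antisymm
    (fun a ha => Set.mem_iInter₂.2 fun y hy => rho_eq_zero_of_mem_singularIdeal ha (hY hy))
    fun a ha => hD.mono fun x hx => ?_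
  by_contra hxD
  obtain ⟨y, hy, hyY⟩ := hdense.inter_open_nonempty _ isOpen_interior
    (nonempty_interior_of_rho_delta_ne_zero hxD hx)
  exact interior_subset hy (rho_delta_eq_zero_of_rho_eq_zero (Set.mem_iInter₂.1 ha y hyY))

theorem singularIdeal_eq_zero (hD : extremelyDangerous G = ∅) : singularIdeal G = {0} := by
  refine Set.eq_singleton_iff_unique_mem.2 ⟨?_, fun a ha => eq_zero_of_forall_rho_eq_zero fun x =>
    rho_eq_zero_of_mem_singularIdeal ha (hD ▸ Set.notMem_empty x)⟩
  simp [singularIdeal, IsMeagre.empty]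

end SingularIdeal

end ArrowGroupoid

theorem proposition1p10_general (G : Type*) [TopologicalSpace G] [ArrowGroupoid G]
    [ArrowGroupoid.IsEtale G] (hD : IsMeagre (ArrowGroupoid.extremelyDangerous G)) :
    (∀ Y : Set (ArrowGroupoid.unitSpace G),
      Y ⊆ (ArrowGroupoid.extremelyDangerous G)ᶜ →
      (ArrowGroupoid.extremelyDangerous G)ᶜ ⊆ closure Y →
        ArrowGroupoid.singularIdeal G =
            {a : ArrowGroupoid.CStarRed G |
              IsMeagre {x : ArrowGroupoid.unitSpace G | ArrowGroupoid.rho x a ≠ 0}} ∧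
        ArrowGroupoid.singularIdeal G =
            ⋂ y ∈ Y, {a : ArrowGroupoid.CStarRed G | ArrowGroupoid.rho y a = 0}) ∧
    (ArrowGroupoid.extremelyDangerous G = ∅ → ArrowGroupoid.singularIdeal G = {0}) :=
  ⟨fun _ hY hYdense => ⟨ArrowGroupoid.singularIdeal_eq_setOf_isMeagre hD,
    ArrowGroupoid.singularIdeal_eq_iInter_ker hD hY hYdense⟩, ArrowGroupoid.singularIdeal_eq_zero⟩

theorem proposition1p10 (G : Type*) [TopologicalSpace G] [ArrowGroupoid G]
    [ArrowGroupoid.IsEtale G]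
    (hcover : ∃ W : ℕ → Set G, (∀ n, ArrowGroupoid.IsOpenBisection (W n)) ∧
      ⋃ n, W n = Set.univ) :
    (∀ Y : Set (ArrowGroupoid.unitSpace G),
      Y ⊆ (ArrowGroupoid.extremelyDangerous G)ᶜ →
      (ArrowGroupoid.extremelyDangerous G)ᶜ ⊆ closure Y →
        ArrowGroupoid.singularIdeal G =
            {a : ArrowGroupoid.CStarRed G |
              IsMeagre {x : ArrowGroupoid.unitSpace G | ArrowGroupoid.rho x a ≠ 0}} ∧
        ArrowGroupoid.singularIdeal G =
            ⋂ y ∈ Y, {a : ArrowGroupoid.CStarRed G | ArrowGroupoid.rho y a = 0}) ∧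
    (ArrowGroupoid.extremelyDangerous G = ∅ → ArrowGroupoid.singularIdeal G = {0}) := by
  obtain ⟨W, hW, hcover⟩ := hcover
  exact proposition1p10_general G (ArrowGroupoid.isMeagre_extremelyDangerous hW hcover)
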